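/- Let $n\ge 1$, write $n=8k+r_0$ with $k\ge 0$ and $1\le r_0\le 8$, and set $$d(n)=\begin{cases}16^k,& r_0=1\\ 2\cdot 16^k,& r_0=2\\ 4\cdot 16^k,& r_0\in\{3,4\}\\ 8\cdot 16^k,& r_0\in\{5,6,7,8\}.\end{cases}$$ Let $\mathrm{Cl}(n)$ be the real Clifford algebra of Euclidean $\mathbb R^n$, with relations $v^2=-\|v\|^2$, let $\mathrm{Spin}(n)\subset \mathrm{Cl}(n)$ be the group of products of an even number of unit vectors, and let $Q_+=\{x\in\mathbb R^n:\|x\|=1\}$. For positive definite inner product spaces $E,S$ equip $E\oplus S$ with the form $b\big((u,s),(u',s')\big)=\langle u,u'\rangle-\langle s,s'\rangle$; for $E=\mathbb R^p$ and $\dim S=q$ this is a model of $\mathbb R^{p,q}$. For $r\ge1$ let $\mathrm{Iso}_{[\![r]\!]}(E\oplus S)$ be the space of flags $F=(F^1\subset\dots\subset F^r)$ of totally isotropic subspaces with $\dim F^i=i$, with its usual topology. Flags $F,F'$ in it are transverse if $F^i+(F'^i)^{\perp_b}=E\oplus S$ for all $1\le i\le r$. A transverse $m$-sphere is a subset homeomorphic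 to $\mathbb S^m$ any two distinct points of which are transverse. The full isotropic flags of $\mathbb R^{p,q}$ are those with $r=\min(p,q)$; for $p=q$ the full flag manifold of $\mathrm{SO}_0(p,p)$ is also modelled by $r=p-1$. (1) Let $\eta:\mathrm{Cl}(n)\to\mathrm{End}_{\mathbb R}(S_n)$ be an irreducible real representation, let $g$ be a spin metric on $S_n$ (an inner product for which every $\eta(x)$, $x\in Q_+$, is orthogonal and every $\eta(x)$, $x\in\mathbb R^n$, is skew-adjoint), and let $S_n^+\subset S_n$ be an irreducible $\mathrm{Spin}(n)$-submodule. Then $\dim_{\mathbb R}S_n^+=d(n)$. Moreover, let $p\ge 1$ and $W=\mathbb R^p\oplus(S_n^+,-g)\cong\mathbb R^{p,d(n)}$, let $x_0\in Q_+$, and for $x\in Q_+$ let $\beta(x)=\mathrm{id}_{\mathbb R^p}\oplus\eta(x_0x)|_{S_n^+}$. Then for every $1\le r\le\min(p,d(n))$ and every $F\in\mathrm{Iso}_{[\![r]\!]}(W)$, in particular for every full isotropic flag $F$ of $W$, the map $x\mapsto\beta(x)\cdot F$ is a topological embedding of $Q_+$ into $\mathrm{Iso}_{[\![r]\!]}(W)$,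 and its image $\{\beta(x)\cdot F: x\in Q_+\}$ is a transverse $(n-1)$-sphere. (2) In particular, if $n\ge2$ and $d=d(n)$, then $\mathrm{Iso}_{[\![d-1]\!]}(\mathbb R^{d-1,d})$ contains a transverse $(n-1)$-sphere. -/

import Mathlib

namespace TransverseSpinor

noncomputable section

open CliffordAlgebra

/-! ### Pseudo-Euclidean spaces and isotropic flags -/

section Flags

variable (E S : Type*) [NormedAddCommGroup E] [InnerProductSpace ℝ E]
  [NormedAddCommGroup S] [InnerProductSpace ℝ S]

/-- The space `E ⊕ S`. It carries the indefinite form `form E S`; the Euclidean (direct sum) norm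
of `WithLp 2` serves only to define the topology of the flag manifolds. -/
abbrev Pseudo : Type _ := WithLp 2 (E × S)

/-- The symmetric bilinear form `⟨u, u'⟩ - ⟨s, s'⟩` on `E ⊕ S`, of signature `(dim E, dim S)`. -/
def form : LinearMap.BilinForm ℝ (Pseudo E S) :=
  (innerₗ E).compl₁₂ (WithLp.fstₗ 2 ℝ E S) (WithLp.fstₗ 2 ℝ E S) -
    (innerₗ S).compl₁₂ (WithLp.sndₗ 2 ℝ E S) (WithLp.sndₗ 2 ℝ E S)

/-- The standard `ℝ^{p,q}`. -/
abbrev Rpq (p q : ℕ) : Type := Pseudo (EuclideanSpace ℝ (Fin p)) (EuclideanSpace ℝ (Fin q))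

/-- The isotropic flags `F¹ ⊂ F² ⊂ ⋯ ⊂ Fʳ` of `E ⊕ S`, where `Fⁱ` is totally isotropic of
dimension `i`; `space i` is the member of dimension `i + 1`, for `i = 0, …, r - 1`. -/
@[ext]
structure IsoFlag (r : ℕ) where
  space : Fin r → Submodule ℝ (Pseudo E S)
  finrank_space : ∀ i, Module.finrank ℝ (space i) = (i : ℕ) + 1
  mono : Monotone space
  isotropic : ∀ i, ∀ u ∈ space i, ∀ v ∈ space i, form E S u v = 0

/-- The isotropic flags of `ℝ^{p,q}` with members of all the dimensions `1, …, r`. -/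
abbrev Iso (p q r : ℕ) : Type := IsoFlag (EuclideanSpace ℝ (Fin p)) (EuclideanSpace ℝ (Fin q)) r

variable {E S}

theorem form_apply (u v : Pseudo E S) :
    form E S u v = inner ℝ u.fst v.fst - inner ℝ u.snd v.snd := rfl

namespace IsoFlag

variable {r : ℕ}

instance (F : IsoFlag E S r) (i : Fin r) : FiniteDimensional ℝ (F.space i) :=
  FiniteDimensional.of_finrank_pos (by rw [F.finrank_space i]; omega)

/-- The usual topology of a flag manifold: a subspace is identified with the orthogonal projection
onto it, and a flag with the tuple of its members. -/
instance : TopologicalSpace (IsoFlag E S r) :=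
  TopologicalSpace.induced
    (fun F (i : Fin r) => ((F.space i).starProjection : Pseudo E S →L[ℝ] Pseudo E S))
    inferInstance

/-- Two flags are transverse if `Vᵏ + (Wᵏ)^⊥` is the whole space for all `k`, with `⊥` taken with
respect to the indefinite form. -/
def Transverse (V W : IsoFlag E S r) : Prop :=
  ∀ i, V.space i ⊔ (form E S).orthogonal (W.space i) = ⊤

/-- The action on flags of a linear automorphism that preserves the form. -/
def map (g : Pseudo E S ≃ₗ[ℝ] Pseudo E S) (hg : ∀ u v, form E S (g u) (g v) = form E S u v)
    (F : IsoFlag E S r) : IsoFlag E S r where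
  space i := (F.space i).map (g : Pseudo E S →ₗ[ℝ] Pseudo E S)
  finrank_space i := by rw [LinearEquiv.finrank_map_eq, F.finrank_space]
  mono _ _ h := Submodule.map_mono (F.mono h)
  isotropic i := by
    rintro _ ⟨u, hu, rfl⟩ _ ⟨v, hv, rfl⟩
    exact (hg u v).trans (F.isotropic i u hu v hv)

/-- A transverse `m`-sphere: a subset of the flag manifold that is homeomorphic to the sphere
`𝕊ᵐ` and whose distinct points are pairwise transverse. -/
def IsTransverseSphere (m : ℕ) (Λ : Set (IsoFlag E S r)) : Prop :=
  Nonempty (Λ ≃ₜ Metric.sphere (0 : EuclideanSpace ℝ (Fin (m + 1))) 1) ∧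
    Λ.Pairwise Transverse

end IsoFlag

/-- The inclusion `g ↦ id ⊕ g` of `O(S)` into the linear automorphisms of `E ⊕ S`. -/
def idSum (g : S ≃ₗᵢ[ℝ] S) : Pseudo E S ≃ₗ[ℝ] Pseudo E S :=
  (WithLp.linearEquiv 2 ℝ (E × S)).trans
    (((LinearEquiv.refl ℝ E).prodCongr g.toLinearEquiv).trans
      (WithLp.linearEquiv 2 ℝ (E × S)).symm)

theorem form_idSum (g : S ≃ₗᵢ[ℝ] S) (u v : Pseudo E S) :
    form E S (idSum g u) (idSum g v) = form E S u v := by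
  have h1 : ∀ w : Pseudo E S, (idSum g w).fst = w.fst := fun _ => rfl
  have h2 : ∀ w : Pseudo E S, (idSum g w).snd = g w.snd := fun _ => rfl
  rw [form_apply, form_apply, h1, h1, h2, h2, g.inner_map_map]

end Flags

/-! ### Clifford modules and spinors -/

/-- The Euclidean space `ℝⁿ`. -/
abbrev V (n : ℕ) : Type := EuclideanSpace ℝ (Fin n)

/-- The quadratic form `x ↦ -‖x‖²` on `ℝⁿ`. -/
def negSq (n : ℕ) : QuadraticForm ℝ (V n) := -(LinearMap.BilinMap.toQuadraticMap (innerₗ (V n)))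

theorem negSq_apply (n : ℕ) (x : V n) : negSq n x = -‖x‖ ^ 2 := by
  simp [negSq]

/-- `Cl(n)`: the real algebra generated by `ℝⁿ` with the relations `x² = -‖x‖²`. -/
abbrev Cl (n : ℕ) : Type := CliffordAlgebra (negSq n)

/-- `Spin(n)`, inside `Cl(n)`. -/
abbrev Spin (n : ℕ) : Submonoid (Cl n) := spinGroup (negSq n)

section Modules

variable {n : ℕ} {S : Type*} [NormedAddCommGroup S] [InnerProductSpace ℝ S]

/-- The inner product of `S` is a spin metric for the representation `η` of `Cl(n)`: unit vectors
of `ℝⁿ` act by orthogonal maps, and all vectors of `ℝⁿ` act by skew-adjoint maps. -/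
structure IsSpinMetric (η : Cl n →ₐ[ℝ] Module.End ℝ S) : Prop where
  orthogonal : ∀ x : V n, ‖x‖ = 1 → ∀ u v : S,
    inner ℝ (η (ι (negSq n) x) u) (η (ι (negSq n) x) v) = inner ℝ u v
  skew : ∀ (x : V n) (u v : S),
    inner ℝ (η (ι (negSq n) x) u) v = -inner ℝ u (η (ι (negSq n) x) v)

/-- A representation of the algebra `Cl(n)`, as a representation of its multiplicative monoid
(the invariant subspaces are the same). -/
def clRep (η : Cl n →ₐ[ℝ] Module.End ℝ S) : Representation ℝ (Cl n) S := (η : Cl n →* Module.End ℝ S)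

/-- The restriction of a representation of `Cl(n)` to `Spin(n)`. -/
def spinRep (η : Cl n →ₐ[ℝ] Module.End ℝ S) : Representation ℝ (Spin n) S :=
  (η : Cl n →* Module.End ℝ S).comp (Spin n).subtype

theorem inner_star {η : Cl n →ₐ[ℝ] Module.End ℝ S} (hη : IsSpinMetric η) (a : Cl n) :
    ∀ u v : S, inner ℝ (η a u) v = inner ℝ u (η (star a) v) := by
  induction a using CliffordAlgebra.induction with
  | algebraMap r =>
    intro u v
    rw [CliffordAlgebra.star_algebraMap, AlgHom.commutes, Module.algebraMap_end_apply,
      Module.algebraMap_end_apply, real_inner_smul_left, real_inner_smul_right]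
  | ι x =>
    intro u v
    rw [CliffordAlgebra.star_ι, map_neg, LinearMap.neg_apply, inner_neg_right, hη.skew]
  | mul a b ha hb =>
    intro u v
    rw [star_mul, map_mul, map_mul, Module.End.mul_apply, Module.End.mul_apply, ha, hb]
  | add a b ha hb =>
    intro u v
    rw [star_add, map_add, map_add, LinearMap.add_apply, LinearMap.add_apply, inner_add_left,
      inner_add_right, ha, hb]

/-- With a spin metric, `Spin(n)` acts on every `Spin(n)`-submodule of `S` by isometries. -/
def spinIsometry {η : Cl n →ₐ[ℝ] Module.End ℝ S} (hη : IsSpinMetric η)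
    (Sp : Subrepresentation (spinRep η)) (g : Spin n) : Sp.toSubmodule ≃ₗᵢ[ℝ] Sp.toSubmodule :=
  LinearEquiv.isometryOfInner
    (LinearEquiv.ofLinearMap (Sp.toRepresentation g) (Sp.toRepresentation g⁻¹)
      (by rw [← Module.End.mul_eq_comp, ← map_mul, mul_inv_cancel, map_one]; rfl)
      (by rw [← Module.End.mul_eq_comp, ← map_mul, inv_mul_cancel, map_one]; rfl))
    (fun u v => by
      change inner ℝ (η (g : Cl n) (u : S)) (η (g : Cl n) (v : S)) = inner ℝ (u : S) (v : S)
      rw [inner_star hη, ← Module.End.mul_apply, ← map_mul,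
        spinGroup.star_mul_self_of_mem g.2, map_one, Module.End.one_apply])

end Modules

theorem unit_sq {n : ℕ} (x : Metric.sphere (0 : V n) 1) :
    ι (negSq n) (x : V n) * ι (negSq n) (x : V n) = -1 := by
  have h : ‖(x : V n)‖ = 1 := by simp
  rw [ι_sq_scalar, negSq_apply, h]
  simp

theorem unit_mem_pin {n : ℕ} (x : Metric.sphere (0 : V n) 1) :
    ι (negSq n) (x : V n) ∈ pinGroup (negSq n) := by
  rw [pinGroup.mem_iff]
  refine ⟨⟨⟨ι (negSq n) (x : V n), -ι (negSq n) (x : V n), ?_, ?_⟩, ?_, rfl⟩, ?_⟩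
  · rw [mul_neg, unit_sq, neg_neg]
  · rw [neg_mul, unit_sq, neg_neg]
  · exact Subgroup.subset_closure ⟨x, rfl⟩
  · rw [Unitary.mem_iff, CliffordAlgebra.star_ι, mul_neg, neg_mul, unit_sq, neg_neg]
    exact ⟨rfl, rfl⟩

/-- The map `f(x) = x₀ x` from the unit sphere of `ℝⁿ` to `Spin(n)`. -/
def sphereToSpin {n : ℕ} (x₀ x : Metric.sphere (0 : V n) 1) : Spin n :=
  ⟨ι (negSq n) (x₀ : V n) * ι (negSq n) (x : V n),
    mul_mem (unit_mem_pin x₀) (unit_mem_pin x), ι_mul_ι_mem_evenOdd_zero (negSq n) _ _⟩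

/-- The map `x ↦ β(x) · F`, where `β(x) = id ⊕ (x₀ x)` acts on `ℝᵖ ⊕ S⁺`, the form of `S⁺` being
the negative of the spin metric. -/
def orbitMap {n : ℕ} {S : Type*} [NormedAddCommGroup S] [InnerProductSpace ℝ S]
    {η : Cl n →ₐ[ℝ] Module.End ℝ S} (hη : IsSpinMetric η) (Sp : Subrepresentation (spinRep η))
    (x₀ : Metric.sphere (0 : V n) 1) {p r : ℕ}
    (F : IsoFlag (EuclideanSpace ℝ (Fin p)) Sp.toSubmodule r) (x : Metric.sphere (0 : V n) 1) :
    IsoFlag (EuclideanSpace ℝ (Fin p)) Sp.toSubmodule r :=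
  F.map (idSum (spinIsometry hη Sp (sphereToSpin x₀ x)))
    (form_idSum (spinIsometry hη Sp (sphereToSpin x₀ x)))

/-- `d(n)`: for `n = 8k + r` with `1 ≤ r ≤ 8`, the number `16ᵏ` times `1, 2, 4, 4, 8, 8, 8, 8` for
`r = 1, …, 8`. (The value at `n = 0` is irrelevant.) -/
def d (n : ℕ) : ℕ :=
  (match (n - 1) % 8 + 1 with
    | 1 => 1
    | 2 => 2
    | 3 => 4
    | 4 => 4
    | _ => 8) * 16 ^ ((n - 1) / 8)

end

end TransverseSpinor

/-!
Two distinct points `x`, `y` of the unit sphere give isometries `g x`, `g y` of the spinor module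
with `‖g x s - g y s‖ = ‖x - y‖ ‖s‖`, so they never agree on a nonzero spinor. For an isotropic
vector `u` with spinor component `s`, the form takes the value `‖g x s - g y s‖² / 2` on the two
translates `g x u`, `g y u`, and `‖u‖² = 2 ‖s‖²`; hence no nonzero vector of `g x Fⁱ` is orthogonal
to `g y Fⁱ`, which is transversality because the two spaces have the same dimension.

The even part of `Cl(n)` is generated by the `n - 1` products `e₀ eᵢ`, which anticommute and have
square `-1`. An irreducible module over anticommuting generators of square `-1` or `1` is
built by periodicity. Adding a pair `e`, `f` with `e² = -1` and `f² = 1` doubles the dimension: the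
new module is `U ⊕ e U` with `U` inside an eigenspace of the involution `e f`, which commutes with
the old generators. Four generators of square `-1` can be exchanged for four of square `1`, and in a
system of involutions one may be kept and multiplied into the others to give them square `-1`. These
moves reduce every `n` to an action of `ℝ`, `ℂ` or `ℍ`, possibly with one more involution that
commutes with it.
-/

namespace TransverseSpinor

open Module CliffordAlgebra

/-! ### Anticommuting elements of a ring -/

section Anticommute

variable {A : Type*} [Ring A]

/-- Two elements of a ring anticommute: the relation between orthogonal vectors in a Clifford
algebra. -/
def Anticommute (a b : A) : Prop := a * b = -(b * a)

namespace Anticommute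

variable {a b c x y : A}

theorem symm (h : Anticommute a b) : Anticommute b a := by
  rw [Anticommute, show a * b = -(b * a) from h, neg_neg]

theorem commute_mul_right (hb : Anticommute a b) (hc : Anticommute a c) : Commute a (b * c) := by
  rw [commute_iff_eq, ← mul_assoc, show a * b = -(b * a) from hb, neg_mul, mul_assoc,
    show a * c = -(c * a) from hc, mul_neg, neg_neg, mul_assoc]

theorem mul_right_of_commute_right (hb : Anticommute a b) (hc : Commute a c) :
    Anticommute a (b * c) := by
  rw [Anticommute, ← mul_assoc, show a * b = -(b * a) from hb, neg_mul, mul_assoc, hc.eq,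
    mul_assoc]

theorem mul_right_of_commute_left (hb : Commute a b) (hc : Anticommute a c) :
    Anticommute a (b * c) := by
  rw [Anticommute, ← mul_assoc, hb.eq, mul_assoc, show a * c = -(c * a) from hc, mul_neg,
    mul_assoc]

theorem mul_self_right (h : Anticommute a b) : Anticommute a (a * b) :=
  mul_right_of_commute_left (Commute.refl a) h

theorem mul_mul_mul_same (h : Anticommute x a) (y : A) : a * x * (a * y) = -(a * a * (x * y)) := by
  rw [mul_assoc, ← mul_assoc x, show x * a = -(a * x) from h, neg_mul, mul_neg]
  simp only [mul_assoc]

theorem mul_mul_of_anticommute (hx : Anticommute x a) (hy : Anticommute y a)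
    (hxy : Anticommute x y) : Anticommute (a * x) (a * y) := by
  rw [Anticommute, hx.mul_mul_mul_same, hy.mul_mul_mul_same, show x * y = -(y * x) from hxy,
    mul_neg]

theorem mul_mul_self_of_sq_eq_neg_one (h : Anticommute a b) (ha : a * a = -1) (hb : b * b = -1) :
    a * b * (a * b) = -1 := by
  rw [h.symm.mul_mul_mul_same, ha, hb, neg_one_mul, neg_neg]

end Anticommute

end Anticommute

section CliffordSystem

variable {A : Type*} [Ring A]

/-- The lists `es` and `fs` consist of pairwise anticommuting elements of a ring; those of `es` have
square `-1` and those of `fs` have square `1`. In an endomorphism ring, this is a module over the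
Clifford algebra of signature `(es.length, fs.length)`. -/
structure CliffordSystem (es fs : List A) : Prop where
  sq_eq_neg_one : ∀ e ∈ es, e * e = -1
  sq_eq_one : ∀ f ∈ fs, f * f = 1
  pairwise : (es ++ fs).Pairwise Anticommute

section Volume

variable {l : List A}

theorem commute_prod_of_length_eq_four (hl : l.length = 4) {x : A}
    (hx : ∀ e ∈ l, Anticommute x e) : Commute x l.prod := by
  match l, hl with
  | [a, b, c, d], _ =>
    simp only [List.forall_mem_cons] at hx
    simpa [mul_assoc] using
      (hx.1.commute_mul_right hx.2.1).mul_right (hx.2.2.1.commute_mul_right hx.2.2.2.1)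

theorem prod_mul_prod_of_length_eq_four (hl : l.length = 4) (hsq : ∀ e ∈ l, e * e = -1)
    (hp : l.Pairwise Anticommute) : l.prod * l.prod = 1 := by
  match l, hl with
  | [a, b, c, d], _ =>
    simp only [List.forall_mem_cons, List.pairwise_cons] at hsq hp
    obtain ⟨⟨hab, hac, had, -⟩, ⟨hbc, hbd, -⟩, ⟨hcd, -⟩, -⟩ := hp
    have hcomm : Commute (a * b) (c * d) :=
      (hac.commute_mul_right had).mul_left (hbc.commute_mul_right hbd)
    have h : a * b * (c * d) * (a * b * (c * d)) = 1 := by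
      rw [hcomm.symm.mul_mul_mul_comm, hab.mul_mul_self_of_sq_eq_neg_one hsq.1 hsq.2.1,
        hcd.mul_mul_self_of_sq_eq_neg_one hsq.2.2.1 hsq.2.2.2.1, neg_one_mul, neg_neg]
    simpa [mul_assoc] using h

theorem anticommute_prod_of_length_eq_four (hl : l.length = 4) (hp : l.Pairwise Anticommute) :
    ∀ e ∈ l, Anticommute e l.prod := by
  match l, hl with
  | [a, b, c, d], _ =>
    simp only [List.forall_mem_cons, List.pairwise_cons] at hp
    obtain ⟨⟨hab, hac, had, -⟩, ⟨hbc, hbd, -⟩, ⟨hcd, -⟩, -⟩ := hp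
    have ha : Anticommute a (a * b * (c * d)) := hab.mul_self_right.mul_right_of_commute_right
      (hac.commute_mul_right had)
    have hb : Anticommute b (a * b * (c * d)) :=
      (hab.symm.mul_right_of_commute_right (.refl b)).mul_right_of_commute_right
        (hbc.commute_mul_right hbd)
    have hc : Anticommute c (a * b * (c * d)) :=
      .mul_right_of_commute_left (hac.symm.commute_mul_right hbc.symm) hcd.mul_self_right
    have hd : Anticommute d (a * b * (c * d)) :=
      .mul_right_of_commute_left (had.symm.commute_mul_right hbd.symm)
        (hcd.symm.mul_right_of_commute_right (.refl d))
    have h : ∀ e ∈ [a, b, c, d], Anticommute e (a * b * (c * d)) := by simp [ha, hb, hc, hd]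
    simpa only [List.prod_cons, List.prod_nil, mul_one, mul_assoc] using h

theorem prod_map_prod_mul_of_length_eq_four (hl : l.length = 4) (hsq : ∀ e ∈ l, e * e = -1)
    (hp : l.Pairwise Anticommute) : (l.map (l.prod * ·)).prod = l.prod := by
  have hmul : ∀ x ∈ l, ∀ y, l.prod * x * (l.prod * y) = -(x * y) := fun x hx y => by
    rw [(anticommute_prod_of_length_eq_four hl hp x hx).mul_mul_mul_same,
      prod_mul_prod_of_length_eq_four hl hsq hp, one_mul]
  match l, hl with
  | [a, b, c, d], _ =>
    set ω := [a, b, c, d].prod with hω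
    calc ([a, b, c, d].map (ω * ·)).prod
      _ = ω * a * (ω * b) * (ω * c * (ω * d)) := by
        simp only [List.map_cons, List.map_nil, List.prod_cons, List.prod_nil, mul_one, mul_assoc]
      _ = a * b * (c * d) := by rw [hmul a (by simp), hmul c (by simp), neg_mul_neg]
      _ = ω := by simp [hω, mul_assoc]

end Volume

namespace CliffordSystem

variable {es fs l : List A}

/-- The product `ω` of four elements commutes with the rest of the system, anticommutes with the
four elements and satisfies `ω² = 1`, so multiplication by `ω` turns their squares into `1`. -/
theorem exchange (hl : l.length = 4) (h : CliffordSystem (l ++ es) fs) :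
    CliffordSystem es (l.map (l.prod * ·) ++ fs) := by
  obtain ⟨hsq, hsq', hp⟩ := h
  rw [List.forall_mem_append] at hsq
  simp only [List.append_assoc, List.pairwise_append] at hp
  obtain ⟨hl_l, ⟨hes, hfs, hes_fs⟩, hl_es⟩ := hp
  have hω := prod_mul_prod_of_length_eq_four hl hsq.1 hl_l
  have hanti := anticommute_prod_of_length_eq_four hl hl_l
  have hcross : ∀ x ∈ es ++ fs, ∀ e ∈ l, Anticommute x (l.prod * e) := fun x hx e he =>
    have hxl : ∀ e ∈ l, Anticommute x e := fun e he => (hl_es e he x hx).symm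
    .mul_right_of_commute_left (commute_prod_of_length_eq_four hl hxl) (hxl e he)
  simp only [List.forall_mem_append] at hcross
  refine ⟨hsq.2, ?_, ?_⟩
  · simp only [List.forall_mem_append, List.forall_mem_map]
    refine ⟨fun e he => ?_, hsq'⟩
    rw [(hanti e he).mul_mul_mul_same, hω, hsq.1 e he, one_mul, neg_neg]
  · simp only [List.pairwise_append, List.forall_mem_append, List.forall_mem_map]
    refine ⟨hes, ⟨?_, hfs, fun e he f hf => (hcross.2 f hf e he).symm⟩,
      fun x hx => ⟨hcross.1 x hx, hes_fs x hx⟩⟩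
    exact List.pairwise_map.2 (hl_l.imp_of_mem fun he he' h =>
      (hanti _ he).mul_mul_of_anticommute (hanti _ he') h)

theorem of_involution {f : A} (h : CliffordSystem [] (f :: fs)) :
    CliffordSystem (fs.map (f * ·)) [f] := by
  obtain ⟨-, hsq, hp⟩ := h
  simp only [List.nil_append, List.pairwise_cons, List.forall_mem_cons] at hp hsq
  have hanti : ∀ x ∈ fs, Anticommute x f := fun x hx => (hp.1 x hx).symm
  refine ⟨?_, by simpa using hsq.1, ?_⟩
  · simp only [List.forall_mem_map]
    intro x hx
    rw [(hanti x hx).mul_mul_mul_same, hsq.1, hsq.2 x hx, one_mul]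
  · simp only [List.pairwise_append, List.pairwise_singleton, List.forall_mem_map,
      List.forall_mem_singleton, List.pairwise_map]
    exact ⟨hp.2.imp_of_mem fun hx hy h => (hanti _ hx).mul_mul_of_anticommute (hanti _ hy) h,
      trivial, fun x hx => (hp.1 x hx).mul_self_right.symm⟩

theorem tail_tail {e f : A} (h : CliffordSystem (e :: es) (f :: fs)) : CliffordSystem es fs where
  sq_eq_neg_one x hx := h.sq_eq_neg_one x (List.mem_cons_of_mem e hx)
  sq_eq_one x hx := h.sq_eq_one x (List.mem_cons_of_mem f hx)
  pairwise := h.pairwise.sublist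
    ((List.sublist_cons_self e es).append (List.sublist_cons_self f fs))

end CliffordSystem

end CliffordSystem

/-! ### Small invariant subspaces -/

section Invariant

variable {K M : Type*} [Field K] [AddCommGroup M] [Module K M]

/-- A submodule preserved by all the endomorphisms in `T`. -/
def IsInvariantUnder (T : Set (End K M)) (U : Submodule K M) : Prop :=
  ∀ g ∈ T, U ∈ g.invtSubmodule

namespace IsInvariantUnder

variable {T : Set (End K M)} {U : Submodule K M}

theorem mem_of_mem_adjoin (hU : IsInvariantUnder T U) {a : End K M}
    (ha : a ∈ Algebra.adjoin K T) : U ∈ a.invtSubmodule := by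
  induction ha using Algebra.adjoin_induction with
  | mem g hg => exact hU g hg
  | algebraMap r => exact fun u hu => U.smul_mem r hu
  | add a b _ _ ha hb => exact fun u hu => U.add_mem (ha hu) (hb hu)
  | mul _ _ _ _ ha hb => exact fun u hu => ha (hb hu)

theorem insert_iff {g : End K M} :
    IsInvariantUnder (insert g T) U ↔ U ∈ g.invtSubmodule ∧ IsInvariantUnder T U :=
  Set.forall_mem_insert

end IsInvariantUnder

/-- Every nonzero subspace that is invariant under the endomorphisms in `T` contains an invariant
subspace of dimension `D`. The ambient space may have infinite dimension. -/
def HasInvariantSubspaces (T : Set (End K M)) (D : ℕ) : Prop :=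
  ∀ N : Submodule K M, N ≠ ⊥ → IsInvariantUnder T N →
    ∃ U ≤ N, IsInvariantUnder T U ∧ FiniteDimensional K U ∧ finrank K U = D

theorem exists_inf_eigenspace_ne_bot {J : End K M} (hJ : J * J = 1) {N : Submodule K M}
    (hN : N ≠ ⊥) (hNJ : N ∈ J.invtSubmodule) : ∃ c : K, c * c = 1 ∧ N ⊓ J.eigenspace c ≠ ⊥ := by
  obtain ⟨v, hv, hv0⟩ := N.ne_bot_iff.1 hN
  by_cases h : v + J v = 0
  · refine ⟨-1, by norm_num, (Submodule.ne_bot_iff _).2 ⟨v, ⟨hv, ?_⟩, hv0⟩⟩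
    simpa using eq_neg_of_add_eq_zero_right h
  · refine ⟨1, by norm_num, (Submodule.ne_bot_iff _).2 ⟨_, ⟨N.add_mem hv (hNJ hv), ?_⟩, h⟩⟩
    have hJv : J (J v) = v := congr($hJ v)
    simp [hJv, add_comm]

section Double

variable {U : Submodule K M} {e f : End K M} {c : K}

theorem finrank_sup_map_of_disjoint [FiniteDimensional K U] (he : Function.Injective e)
    (h : Disjoint U (U.map e)) : finrank K ↥(U ⊔ U.map e) = 2 * finrank K U := by
  rw [← add_zero (finrank K ↥(U ⊔ U.map e)), ← finrank_bot K M, ← h.eq_bot,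
    Submodule.finrank_sup_add_finrank_inf_eq,
    ← (Submodule.equivMapOfInjective e he U).finrank_eq, two_mul]

theorem disjoint_map_of_le_eigenspace [NeZero (2 : K)] (hef : Anticommute (e * f) e) (hc : c ≠ 0)
    (hU : U ≤ (e * f).eigenspace c) : Disjoint U (U.map e) := by
  have hneg : U.map e ≤ (e * f).eigenspace (-c) := by
    rintro _ ⟨u, hu, rfl⟩
    have h : (e * f) (e u) = -e ((e * f) u) := congr($hef u)
    rw [End.mem_eigenspace_iff, h, End.mem_eigenspace_iff.1 (hU hu), map_smul, neg_smul]
  have hcc : c ≠ -c := fun h =>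
    mul_ne_zero two_ne_zero hc (by rw [two_mul, ← eq_neg_iff_add_eq_zero, ← h])
  exact (End.disjoint_genEigenspace (e * f) hcc 1 1).mono hU hneg

theorem sup_map_mem_invtSubmodule_self (he : e * e = -1) : U ⊔ U.map e ∈ e.invtSubmodule := by
  rw [End.mem_invtSubmodule_iff_map_le, Submodule.map_sup, ← Submodule.map_comp]
  refine sup_le le_sup_right (le_sup_of_le_left ?_)
  rw [← End.mul_eq_comp, he, Submodule.map_neg]
  exact (Submodule.map_id U).le

theorem sup_map_mem_invtSubmodule_of_anticommute {g : End K M} (hge : Anticommute g e)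
    (hg : U ∈ g.invtSubmodule) : U ⊔ U.map e ∈ g.invtSubmodule := by
  rw [End.mem_invtSubmodule_iff_map_le] at hg ⊢
  rw [Submodule.map_sup, ← Submodule.map_comp, ← End.mul_eq_comp, hge, Submodule.map_neg,
    End.mul_eq_comp, Submodule.map_comp]
  exact sup_le_sup hg (Submodule.map_mono hg)

theorem sup_map_mem_invtSubmodule_of_le_eigenspace (he : e * e = -1) (hfe : Anticommute f e)
    (hU : U ≤ (e * f).eigenspace c) : U ⊔ U.map e ∈ f.invtSubmodule := by
  have hfu : ∀ u ∈ U, f u = -(c • e u) := fun u hu => by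
    have h : e (e (f u)) = -f u := congr($he (f u))
    rw [← map_smul, ← End.mem_eigenspace_iff.1 (hU hu), End.mul_apply, h, neg_neg]
  have hfeu : ∀ u ∈ U, f (e u) = -(c • u) := fun u hu => by
    have h : f (e u) = -e (f u) := congr($hfe u)
    rw [h, ← End.mem_eigenspace_iff.1 (hU hu), End.mul_apply]
  rw [End.mem_invtSubmodule_iff_map_le, Submodule.map_sup]
  refine sup_le ?_ ?_
  · rintro _ ⟨u, hu, rfl⟩
    rw [hfu u hu]
    exact Submodule.mem_sup_right (neg_mem (Submodule.smul_mem _ c (Submodule.mem_map_of_mem hu)))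
  · rintro _ ⟨_, ⟨u, hu, rfl⟩, rfl⟩
    rw [hfeu u hu]
    exact Submodule.mem_sup_left (neg_mem (U.smul_mem c hu))

end Double

namespace HasInvariantSubspaces

variable {T T' : Set (End K M)} {J e f : End K M} {D : ℕ}

theorem of_adjoin (h : HasInvariantSubspaces T D) (hT : T ⊆ Algebra.adjoin K T')
    (hT' : T' ⊆ Algebra.adjoin K T) : HasInvariantSubspaces T' D := fun N hN hNT' =>
  have ⟨U, hUN, hUT, hU⟩ := h N hN fun _ hg => hNT'.mem_of_mem_adjoin (hT hg)
  ⟨U, hUN, fun _ hg => hUT.mem_of_mem_adjoin (hT' hg), hU⟩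

theorem exists_le_eigenspace (h : HasInvariantSubspaces T D) (hJ : J * J = 1)
    (hTJ : ∀ g ∈ T, Commute g J) {N : Submodule K M} (hN : N ≠ ⊥) (hNT : IsInvariantUnder T N)
    (hNJ : N ∈ J.invtSubmodule) : ∃ c : K, c * c = 1 ∧ ∃ U ≤ N, U ≤ J.eigenspace c ∧
      IsInvariantUnder T U ∧ FiniteDimensional K U ∧ finrank K U = D := by
  obtain ⟨c, hc, hNc⟩ := exists_inf_eigenspace_ne_bot hJ hN hNJ
  obtain ⟨U, hU, hUT⟩ := h _ hNc fun g hg =>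
    End.invtSubmodule.inf_mem (hNT g hg) (End.mapsTo_genEigenspace_of_comm (hTJ g hg).symm c 1)
  exact ⟨c, hc, U, hU.trans inf_le_left, hU.trans inf_le_right, hUT⟩

theorem insert_of_commute (h : HasInvariantSubspaces T D) (hJ : J * J = 1)
    (hTJ : ∀ g ∈ T, Commute g J) : HasInvariantSubspaces (insert J T) D := by
  intro N hN hNT
  rw [IsInvariantUnder.insert_iff] at hNT
  obtain ⟨c, -, U, hUN, hUJ, hUT, hU⟩ := h.exists_le_eigenspace hJ hTJ hN hNT.2 hNT.1
  refine ⟨U, hUN, IsInvariantUnder.insert_iff.2 ⟨fun u hu => ?_, hUT⟩, hU⟩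
  rw [Submodule.mem_comap, End.mem_eigenspace_iff.1 (hUJ hu)]
  exact U.smul_mem c hu

theorem double [NeZero (2 : K)] (h : HasInvariantSubspaces T D) (he : e * e = -1) (hf : f * f = 1)
    (hef : Anticommute e f) (hTe : ∀ g ∈ T, Anticommute g e) (hTf : ∀ g ∈ T, Anticommute g f) :
    HasInvariantSubspaces (insert e (insert f T)) (2 * D) := by
  have hJ : e * f * (e * f) = 1 := by rw [hef.symm.mul_mul_mul_same, he, hf, mul_one, neg_neg]
  have heJ : Anticommute (e * f) e := hef.mul_self_right.symm
  have hinj : Function.Injective e := fun u v huv => by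
    have h : ∀ w, e (e w) = -w := fun w => congr($he w)
    simpa [h] using congr(e $huv)
  intro N hN hNT
  simp only [IsInvariantUnder.insert_iff] at hNT ⊢
  obtain ⟨hNe, hNf, hNT⟩ := hNT
  obtain ⟨c, hc, U, hUN, hUJ, hUT, hUfin, hUD⟩ := h.exists_le_eigenspace hJ
    (fun g hg => (hTe g hg).commute_mul_right (hTf g hg)) hN hNT fun u hu => hNe (hNf hu)
  have hc0 : c ≠ 0 := fun h0 => by simp [h0] at hc
  refine ⟨U ⊔ U.map e, sup_le hUN ?_, ⟨sup_map_mem_invtSubmodule_self he,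
    sup_map_mem_invtSubmodule_of_le_eigenspace he hef.symm hUJ,
    fun g hg => sup_map_mem_invtSubmodule_of_anticommute (hTe g hg) (hUT g hg)⟩, inferInstance, ?_⟩
  · exact (Submodule.map_mono hUN).trans ((End.mem_invtSubmodule_iff_map_le e).1 hNe)
  · rw [finrank_sup_map_of_disjoint hinj (disjoint_map_of_le_eigenspace heJ hc0 hUJ), hUD]

theorem of_algHom {L : Type*} [DivisionRing L] [Algebra K L] [FiniteDimensional K L]
    (φ : L →ₐ[K] End K M) (hT : Algebra.adjoin K T = φ.range) :
    HasInvariantSubspaces T (finrank K L) := by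
  intro N hN hNT
  obtain ⟨v, hv, hv0⟩ := N.ne_bot_iff.1 hN
  let θ : L →ₗ[K] M := (LinearMap.applyₗ v).comp φ.toLinearMap
  have hθ : Function.Injective θ := (injective_iff_map_eq_zero θ).2 fun q hq => by
    by_contra hq0
    refine hv0 ?_
    calc v = φ (q⁻¹ * q) v := by rw [inv_mul_cancel₀ hq0, map_one, End.one_apply]
      _ = φ q⁻¹ (θ q) := by rw [map_mul]; rfl
      _ = 0 := by rw [hq, map_zero]
  refine ⟨θ.range, ?_, fun g hg => ?_, inferInstance, LinearMap.finrank_range_of_inj hθ⟩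
  · rintro _ ⟨q, rfl⟩
    exact hNT.mem_of_mem_adjoin (hT ▸ ⟨q, rfl⟩) hv
  · obtain ⟨a, rfl⟩ := hT ▸ Algebra.subset_adjoin hg
    rintro _ ⟨q, rfl⟩
    exact ⟨a * q, congr($(map_mul φ a q) v)⟩

end HasInvariantSubspaces

end Invariant

section DivisionAlgebras

variable {M : Type*} [AddCommGroup M] [Module ℝ M] {e₀ e₁ e₂ : End ℝ M}

theorem hasInvariantSubspaces_empty {K M : Type*} [Field K] [AddCommGroup M] [Module K M] :
    HasInvariantSubspaces (∅ : Set (End K M)) 1 := by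
  rw [← finrank_self K]
  exact .of_algHom (Algebra.ofId K (End K M)) (by rw [Algebra.adjoin_empty]; rfl)

theorem hasInvariantSubspaces_singleton (h₀ : e₀ * e₀ = -1) : HasInvariantSubspaces {e₀} 2 := by
  rw [← Complex.finrank_real_complex]
  refine .of_algHom (Complex.liftAux e₀ h₀) ?_
  rw [← Algebra.map_top, ← Complex.adjoin_I, AlgHom.map_adjoin_singleton, Complex.liftAux_apply_I]

theorem hasInvariantSubspaces_pair (h₀ : e₀ * e₀ = -1) (h₁ : e₁ * e₁ = -1)
    (h₀₁ : Anticommute e₀ e₁) : HasInvariantSubspaces {e₀, e₁} 4 := by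
  let B : QuaternionAlgebra.Basis (End ℝ M) (-1 : ℝ) 0 (-1) :=
    { i := e₀, j := e₁, k := e₀ * e₁, i_mul_i := by simp [h₀], j_mul_j := by simp [h₁]
      i_mul_j := rfl, j_mul_i := by rw [zero_smul, zero_sub]; exact h₀₁.symm }
  let φ : Quaternion ℝ →ₐ[ℝ] End ℝ M := B.liftHom
  rw [← Quaternion.finrank_eq_four (R := ℝ)]
  refine (HasInvariantSubspaces.of_algHom φ B.range_liftHom.symm).of_adjoin ?_ ?_
  · have he₀ : e₀ ∈ Algebra.adjoin ℝ {e₀, e₁} := Algebra.subset_adjoin (by simp)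
    have he₁ : e₁ ∈ Algebra.adjoin ℝ {e₀, e₁} := Algebra.subset_adjoin (by simp)
    simpa [B, Set.insert_subset_iff] using ⟨he₀, he₁, mul_mem he₀ he₁⟩
  · exact subset_trans (by simp [B, Set.insert_subset_iff]) Algebra.subset_adjoin

theorem hasInvariantSubspaces_triple (h₀ : e₀ * e₀ = -1) (h₁ : e₁ * e₁ = -1) (h₂ : e₂ * e₂ = -1)
    (h₀₁ : Anticommute e₀ e₁) (h₀₂ : Anticommute e₀ e₂) (h₁₂ : Anticommute e₁ e₂) :
    HasInvariantSubspaces {e₀, e₁, e₂} 4 := by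
  set J := e₀ * (e₁ * e₂) with hJ
  have h₀J : Commute e₀ J := (Commute.refl e₀).mul_right (h₀₁.commute_mul_right h₀₂)
  have h₁J : Commute e₁ J := h₀₁.symm.commute_mul_right h₁₂.mul_self_right
  have hJJ : J * J = 1 := by
    rw [hJ, (h₀₁.commute_mul_right h₀₂).symm.mul_mul_mul_comm, h₀,
      h₁₂.mul_mul_self_of_sq_eq_neg_one h₁ h₂, neg_one_mul, neg_neg]
  have he₂ : e₂ = e₁ * (e₀ * J) := by
    rw [hJ, ← mul_assoc e₀, h₀, neg_one_mul, mul_neg, ← mul_assoc, h₁, neg_one_mul, neg_neg]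
  refine ((hasInvariantSubspaces_pair h₀ h₁ h₀₁).insert_of_commute hJJ (by simp [h₀J, h₁J]))
    |>.of_adjoin ?_ ?_
  · have hmem : ∀ g ∈ ({e₀, e₁, e₂} : Set (End ℝ M)), g ∈ Algebra.adjoin ℝ {e₀, e₁, e₂} :=
      fun g hg => Algebra.subset_adjoin hg
    simp only [Set.forall_mem_insert, Set.mem_singleton_iff, forall_eq] at hmem
    simp only [Set.insert_subset_iff, Set.singleton_subset_iff, SetLike.mem_coe]
    exact ⟨mul_mem hmem.1 (mul_mem hmem.2.1 hmem.2.2), hmem.1, hmem.2.1⟩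
  · have hmem : ∀ g ∈ ({J, e₀, e₁} : Set (End ℝ M)), g ∈ Algebra.adjoin ℝ {J, e₀, e₁} :=
      fun g hg => Algebra.subset_adjoin hg
    simp only [Set.forall_mem_insert, Set.mem_singleton_iff, forall_eq] at hmem
    simp only [Set.insert_subset_iff, Set.singleton_subset_iff, SetLike.mem_coe]
    exact ⟨hmem.2.1, hmem.2.2, he₂ ▸ mul_mem hmem.2.2 (mul_mem hmem.2.1 hmem.1)⟩

end DivisionAlgebras

/-! ### The periodicity of Clifford modules -/

section Periodicity

universe u

/-- Every Clifford system of `p` elements of square `-1` and `q` elements of square `1` in the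
endomorphism ring of a real vector space has invariant subspaces of dimension `D`. -/
def SignatureHasInvariantSubspaces (p q D : ℕ) : Prop :=
  ∀ (M : Type u) [AddCommGroup M] [Module ℝ M] (es fs : List (End ℝ M)), es.length = p →
    fs.length = q → CliffordSystem es fs → HasInvariantSubspaces {g | g ∈ es ++ fs} D

namespace SignatureHasInvariantSubspaces

variable {p q D : ℕ}

theorem double (h : SignatureHasInvariantSubspaces.{u} p q D) :
    SignatureHasInvariantSubspaces.{u} (p + 1) (q + 1) (2 * D) := by
  intro M _ _ es' fs' hp hq hs
  obtain ⟨e, es, rfl⟩ := List.exists_cons_of_length_eq_add_one hp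
  obtain ⟨f, fs, rfl⟩ := List.exists_cons_of_length_eq_add_one hq
  have hperm : (e :: es ++ f :: fs).Perm (e :: f :: (es ++ fs)) := List.perm_middle.cons e
  have hset : {g | g ∈ e :: es ++ f :: fs} = insert e (insert f {g | g ∈ es ++ fs}) :=
    Set.ext fun g => hperm.mem_iff.trans (by simp)
  have hanti := (hperm.pairwise_iff fun h => h.symm).1 hs.pairwise
  simp only [List.pairwise_cons, List.forall_mem_cons] at hanti
  obtain ⟨⟨hef, he⟩, hf, -⟩ := hanti
  rw [hset]
  exact (h M es fs (by simpa using hp) (by simpa using hq) hs.tail_tail).double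
    (hs.sq_eq_neg_one e (by simp)) (hs.sq_eq_one f (by simp)) hef
    (fun g hg => (he g hg).symm) (fun g hg => (hf g hg).symm)

theorem exchange (h : SignatureHasInvariantSubspaces.{u} p (q + 4) D) :
    SignatureHasInvariantSubspaces.{u} (p + 4) q D := by
  intro M _ _ es' fs hp hq hs
  obtain ⟨l, es, hl, hes, rfl⟩ : ∃ l es : List (End ℝ M), l.length = 4 ∧ es.length = p ∧
      es' = l ++ es := ⟨es'.take 4, es'.drop 4, by simp [hp], by simp [hp], by simp⟩
  refine (h M es (l.map (l.prod * ·) ++ fs) hes (by simp [hl, hq, add_comm])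
    (hs.exchange hl)).of_adjoin ?_ ?_
  · set C := Algebra.adjoin ℝ {g | g ∈ l ++ es ++ fs}
    have hmem : ∀ g ∈ l ++ es ++ fs, g ∈ C := fun g hg => Algebra.subset_adjoin hg
    simp only [List.forall_mem_append] at hmem
    have hω : l.prod ∈ C := list_prod_mem hmem.1.1
    suffices ∀ g ∈ es ++ (l.map (l.prod * ·) ++ fs), g ∈ C from this
    simp only [List.forall_mem_append, List.forall_mem_map]
    exact ⟨hmem.1.2, fun e he => mul_mem hω (hmem.1.1 e he), hmem.2⟩
  · set C := Algebra.adjoin ℝ {g | g ∈ es ++ (l.map (l.prod * ·) ++ fs)}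
    have hmem : ∀ g ∈ es ++ (l.map (l.prod * ·) ++ fs), g ∈ C :=
      fun g hg => Algebra.subset_adjoin hg
    have hsq : ∀ e ∈ l, e * e = -1 := fun e he =>
      hs.sq_eq_neg_one e (List.mem_append_left es he)
    have hpair : l.Pairwise Anticommute :=
      (List.pairwise_append.1 (List.pairwise_append.1 hs.pairwise).1).1
    simp only [List.forall_mem_append] at hmem
    have hω : l.prod ∈ C :=
      prod_map_prod_mul_of_length_eq_four hl hsq hpair ▸ list_prod_mem hmem.2.1
    have hl_mem : ∀ e ∈ l, e ∈ C := fun e he => by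
      rw [← one_mul e, ← prod_mul_prod_of_length_eq_four hl hsq hpair, mul_assoc]
      exact mul_mem hω (hmem.2.1 _ (List.mem_map_of_mem he))
    suffices ∀ g ∈ l ++ es ++ fs, g ∈ C from this
    simp only [List.forall_mem_append]
    exact ⟨⟨hl_mem, hmem.1⟩, hmem.2.2⟩

theorem of_involution (h : SignatureHasInvariantSubspaces.{u} q 1 D) :
    SignatureHasInvariantSubspaces.{u} 0 (q + 1) D := by
  intro M _ _ es fs' hp hq hs
  obtain rfl := List.length_eq_zero_iff.1 hp
  obtain ⟨f, fs, rfl⟩ := List.exists_cons_of_length_eq_add_one hq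
  refine (h M (fs.map (f * ·)) [f] (by simpa using hq) rfl hs.of_involution).of_adjoin ?_ ?_
  · set C := Algebra.adjoin ℝ {g | g ∈ [] ++ f :: fs}
    have hmem : ∀ g ∈ f :: fs, g ∈ C := fun g hg => Algebra.subset_adjoin hg
    rw [List.forall_mem_cons] at hmem
    suffices ∀ g ∈ fs.map (f * ·) ++ [f], g ∈ C from this
    rw [List.forall_mem_append, List.forall_mem_map, List.forall_mem_singleton]
    exact ⟨fun x hx => mul_mem hmem.1 (hmem.2 x hx), hmem.1⟩
  · set C := Algebra.adjoin ℝ {g | g ∈ fs.map (f * ·) ++ [f]}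
    have hmem : ∀ g ∈ fs.map (f * ·) ++ [f], g ∈ C := fun g hg => Algebra.subset_adjoin hg
    rw [List.forall_mem_append, List.forall_mem_map, List.forall_mem_singleton] at hmem
    suffices ∀ g ∈ f :: fs, g ∈ C from this
    refine List.forall_mem_cons.2 ⟨hmem.2, fun x hx => ?_⟩
    rw [← one_mul x, ← hs.sq_eq_one f List.mem_cons_self, mul_assoc]
    exact mul_mem hmem.2 (hmem.1 x hx)

end SignatureHasInvariantSubspaces

theorem signatureHasInvariantSubspaces_zero_zero :
    SignatureHasInvariantSubspaces.{u} 0 0 1 := by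
  intro M _ _ es fs hp hq _
  obtain rfl := List.length_eq_zero_iff.1 hp
  obtain rfl := List.length_eq_zero_iff.1 hq
  simpa using hasInvariantSubspaces_empty

theorem signatureHasInvariantSubspaces_zero_one :
    SignatureHasInvariantSubspaces.{u} 0 1 1 := by
  intro M _ _ es fs hp hq hs
  obtain rfl := List.length_eq_zero_iff.1 hp
  obtain ⟨f, rfl⟩ := List.length_eq_one_iff.1 hq
  simpa [Set.insert_def] using
    hasInvariantSubspaces_empty.insert_of_commute (hs.sq_eq_one f (by simp)) (by simp)

theorem signatureHasInvariantSubspaces_one_zero :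
    SignatureHasInvariantSubspaces.{u} 1 0 2 := by
  intro M _ _ es fs hp hq hs
  obtain ⟨e, rfl⟩ := List.length_eq_one_iff.1 hp
  obtain rfl := List.length_eq_zero_iff.1 hq
  simpa using hasInvariantSubspaces_singleton (hs.sq_eq_neg_one e (by simp))

theorem signatureHasInvariantSubspaces_two_zero :
    SignatureHasInvariantSubspaces.{u} 2 0 4 := by
  intro M _ _ es fs hp hq hs
  obtain ⟨e₀, e₁, rfl⟩ := List.length_eq_two.1 hp
  obtain rfl := List.length_eq_zero_iff.1 hq
  have hset : {g | g ∈ [e₀, e₁] ++ []} = ({e₀, e₁} : Set (End ℝ M)) := by ext; simp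
  rw [hset]
  exact hasInvariantSubspaces_pair (hs.sq_eq_neg_one e₀ (by simp)) (hs.sq_eq_neg_one e₁ (by simp))
    (by simpa using hs.pairwise)

theorem signatureHasInvariantSubspaces_three_zero :
    SignatureHasInvariantSubspaces.{u} 3 0 4 := by
  intro M _ _ es fs hp hq hs
  obtain ⟨e₀, e₁, e₂, rfl⟩ := List.length_eq_three.1 hp
  obtain rfl := List.length_eq_zero_iff.1 hq
  have hset : {g | g ∈ [e₀, e₁, e₂] ++ []} = ({e₀, e₁, e₂} : Set (End ℝ M)) := by ext; simp
  obtain ⟨⟨h₀₁, h₀₂⟩, h₁₂⟩ : (Anticommute e₀ e₁ ∧ Anticommute e₀ e₂) ∧ Anticommute e₁ e₂ := by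
    simpa using hs.pairwise
  rw [hset]
  exact hasInvariantSubspaces_triple (hs.sq_eq_neg_one e₀ (by simp))
    (hs.sq_eq_neg_one e₁ (by simp)) (hs.sq_eq_neg_one e₂ (by simp)) h₀₁ h₀₂ h₁₂

theorem d_succ_add_eight (m : ℕ) : d (m + 8 + 1) = 2 * (2 * (2 * (2 * d (m + 1)))) := by
  have h1 : (m + 8) % 8 = m % 8 := by omega
  have h2 : (m + 8) / 8 = m / 8 + 1 := by omega
  simp only [d, Nat.add_sub_cancel, h1, h2, pow_succ]
  ring

theorem signatureHasInvariantSubspaces_d :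
    ∀ m : ℕ, SignatureHasInvariantSubspaces.{u} m 0 (d (m + 1))
  | 0 => signatureHasInvariantSubspaces_zero_zero
  | 1 => signatureHasInvariantSubspaces_one_zero
  | 2 => signatureHasInvariantSubspaces_two_zero
  | 3 => signatureHasInvariantSubspaces_three_zero
  | 4 => signatureHasInvariantSubspaces_two_zero.double.of_involution.exchange
  | 5 => signatureHasInvariantSubspaces_one_zero.double.of_involution.double.exchange
  | 6 => signatureHasInvariantSubspaces_zero_zero.double.of_involution.double.double.exchange
  | 7 => signatureHasInvariantSubspaces_zero_one.double.double.double.exchange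
  | m + 8 => by
    rw [d_succ_add_eight]
    exact (signatureHasInvariantSubspaces_d m).double.double.double.double.exchange

end Periodicity

/-! ### Transverse orbits of isotropic flags -/

theorem sup_orthogonal_eq_top {K M : Type*} [Field K] [AddCommGroup M] [Module K M]
    {B : LinearMap.BilinForm K M} {U W : Submodule K M} [FiniteDimensional K U]
    [FiniteDimensional K W] (hfin : finrank K U = finrank K W)
    (hUW : ∀ u ∈ U, (∀ w ∈ W, B w u = 0) → u = 0) : U ⊔ B.orthogonal W = ⊤ := by
  let θ : M →ₗ[K] Dual K W := W.dualRestrict ∘ₗ B.flip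
  have hker : θ.ker = B.orthogonal W := by
    ext v
    rw [LinearMap.mem_ker, LinearMap.ext_iff]
    exact Subtype.forall
  have hinj : Function.Injective (θ.domRestrict U) := by
    refine (injective_iff_map_eq_zero _).2 fun u hu => Subtype.ext (hUW u u.2 fun w hw => ?_)
    exact congr($hu ⟨w, hw⟩)
  have hsurj : U.map θ = ⊤ := by
    rw [← LinearMap.range_domRestrict, LinearMap.range_eq_top]
    exact (LinearMap.injective_iff_surjective_of_finrank_eq_finrank
      (hfin.trans Subspace.dual_finrank_eq.symm)).1 hinj
  rw [← hker, ← Submodule.comap_map_eq, hsurj, Submodule.comap_top]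

theorem continuous_of_norm_sub_le {P X Y : Type*} [TopologicalSpace P] [SeminormedAddCommGroup X]
    [SeminormedAddCommGroup Y] {f : P → X} {g : P → Y} (hg : Continuous g)
    (h : ∀ x y, ‖f x - f y‖ ≤ ‖g x - g y‖) : Continuous f :=
  continuous_iff_continuousAt.2 fun y => tendsto_iff_norm_sub_tendsto_zero.2 <|
    squeeze_zero (fun _ => norm_nonneg _) (fun x => h x y)
      (tendsto_iff_norm_sub_tendsto_zero.1 (hg.tendsto y))

theorem continuous_symm_of_continuous {P X : Type*} [TopologicalSpace P] [NormedAddCommGroup X]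
    [NormedSpace ℝ X] {T : P → X ≃ₗᵢ[ℝ] X} (hT : Continuous fun x => (T x : X →L[ℝ] X)) :
    Continuous fun x => ((T x).symm : X →L[ℝ] X) := by
  refine continuous_of_norm_sub_le hT fun x y => ?_
  refine ContinuousLinearMap.opNorm_le_bound _ (norm_nonneg _) fun w => ?_
  calc ‖(T x).symm w - (T y).symm w‖ = ‖T x ((T y).symm w) - T y ((T y).symm w)‖ := by
        rw [LinearIsometryEquiv.apply_symm_apply, norm_sub_rev, ← (T x).norm_map, map_sub,
          LinearIsometryEquiv.apply_symm_apply]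
    _ ≤ ‖(T x : X →L[ℝ] X) - (T y : X →L[ℝ] X)‖ * ‖(T y).symm w‖ :=
        ((T x : X →L[ℝ] X) - (T y : X →L[ℝ] X)).le_opNorm _
    _ = _ := by rw [(T y).symm.norm_map]

section TransverseFamily

variable {E S P : Type*} [NormedAddCommGroup E] [InnerProductSpace ℝ E]
  [NormedAddCommGroup S] [InnerProductSpace ℝ S] [TopologicalSpace P] {r : ℕ}

@[simp]
theorem idSum_fst (g : S ≃ₗᵢ[ℝ] S) (w : Pseudo E S) : (idSum g w).fst = w.fst := rfl

@[simp]
theorem idSum_snd (g : S ≃ₗᵢ[ℝ] S) (w : Pseudo E S) : (idSum g w).snd = g w.snd := rfl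

theorem norm_fst_eq_norm_snd {u : Pseudo E S} (hu : form E S u u = 0) : ‖u.fst‖ = ‖u.snd‖ := by
  rw [form_apply, real_inner_self_eq_norm_sq, real_inner_self_eq_norm_sq, sub_eq_zero] at hu
  exact (sq_eq_sq₀ (norm_nonneg _) (norm_nonneg _)).1 hu

theorem eq_zero_of_snd_eq_zero {u : Pseudo E S} (hu : form E S u u = 0) (h : u.snd = 0) :
    u = 0 := by
  have hfst : u.fst = 0 := by rw [← norm_eq_zero, norm_fst_eq_norm_snd hu, h, norm_zero]
  exact WithLp.ofLp_injective 2 (Prod.ext hfst h)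

theorem form_idSum_idSum (g h : S ≃ₗᵢ[ℝ] S) {u : Pseudo E S} (hu : form E S u u = 0) :
    form E S (idSum g u) (idSum h u) = ‖g u.snd - h u.snd‖ ^ 2 / 2 := by
  rw [norm_sub_sq_real, g.norm_map, h.norm_map, form_apply, idSum_fst, idSum_fst, idSum_snd,
    idSum_snd, real_inner_self_eq_norm_sq, norm_fst_eq_norm_snd hu]
  ring

/-- The automorphism `id ⊕ g` as an isometry of the Euclidean norm of `E ⊕ S`. -/
noncomputable def idSumIsometry (g : S ≃ₗᵢ[ℝ] S) : Pseudo E S ≃ₗᵢ[ℝ] Pseudo E S :=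
  (idSum g).isometryOfInner fun u v => by
    rw [WithLp.prod_inner_apply, WithLp.prod_inner_apply]
    exact congr(_ + $(g.inner_map_map u.snd v.snd))

theorem norm_idSumIsometry_sub_le (g h : S ≃ₗᵢ[ℝ] S) :
    ‖((idSumIsometry g : Pseudo E S ≃ₗᵢ[ℝ] Pseudo E S) : Pseudo E S →L[ℝ] Pseudo E S) -
        (idSumIsometry h : Pseudo E S ≃ₗᵢ[ℝ] Pseudo E S)‖ ≤
      ‖(g : S →L[ℝ] S) - (h : S →L[ℝ] S)‖ := by
  refine ContinuousLinearMap.opNorm_le_bound _ (norm_nonneg _) fun u => ?_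
  calc ‖idSumIsometry g u - idSumIsometry h u‖ = ‖WithLp.toLp 2 ((0 : E), g u.snd - h u.snd)‖ :=
        congrArg norm (WithLp.ofLp_injective 2 (Prod.ext (sub_self u.fst) rfl))
    _ = ‖((g : S →L[ℝ] S) - (h : S →L[ℝ] S)) u.snd‖ := WithLp.norm_toLp_snd 2 E S _
    _ ≤ ‖(g : S →L[ℝ] S) - (h : S →L[ℝ] S)‖ * ‖u.snd‖ := ContinuousLinearMap.le_opNorm _ _
    _ ≤ _ := by gcongr; exact WithLp.norm_snd_le _ u

instance : T2Space (IsoFlag E S r) :=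
  .of_injective_continuous
    (f := fun F (i : Fin r) => ((F.space i).starProjection : Pseudo E S →L[ℝ] Pseudo E S))
    (fun _ _ h => IsoFlag.ext (funext fun i => Submodule.starProjection_inj.1 (congrFun h i)))
    continuous_induced_dom

/-- A continuous family of isometries of `S` no two members of which agree on a nonzero vector. Its
orbits in the flag manifolds of `E ⊕ S` are transverse. -/
structure IsTransverseFamily (g : P → S ≃ₗᵢ[ℝ] S) : Prop where
  continuous : Continuous fun x => (g x : S →L[ℝ] S)
  eq_zero_of_apply_eq : ∀ ⦃x y⦄, x ≠ y → ∀ s, g x s = g y s → s = 0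

namespace IsTransverseFamily

variable {g : P → S ≃ₗᵢ[ℝ] S}

theorem conj (hg : IsTransverseFamily g) {S' : Type*} [NormedAddCommGroup S']
    [InnerProductSpace ℝ S'] (φ : S ≃ₗᵢ[ℝ] S') :
    IsTransverseFamily fun x => φ.symm.trans ((g x).trans φ) where
  continuous := (continuous_const (y := (φ : S →L[ℝ] S'))).clm_comp
    (hg.continuous.clm_comp (continuous_const (y := (φ.symm : S' →L[ℝ] S))))
  eq_zero_of_apply_eq x y hxy s h := by
    simpa using hg.eq_zero_of_apply_eq hxy (φ.symm s) (φ.injective h)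

theorem eq_zero_of_form_eq_zero (hg : IsTransverseFamily g) {x y : P} (hxy : x ≠ y)
    {u : Pseudo E S} (hu : form E S u u = 0)
    (h : form E S (idSum (g x) u) (idSum (g y) u) = 0) : u = 0 := by
  refine eq_zero_of_snd_eq_zero hu (hg.eq_zero_of_apply_eq hxy _ ?_)
  rw [form_idSum_idSum _ _ hu] at h
  simpa [sub_eq_zero] using h

variable (F : IsoFlag E S r)

theorem transverse_map (hg : IsTransverseFamily g) {x y : P} (hxy : x ≠ y) :
    (F.map (idSum (g x)) (form_idSum (g x))).Transverse
      (F.map (idSum (g y)) (form_idSum (g y))) := by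
  refine fun i => sup_orthogonal_eq_top (by simp only [IsoFlag.finrank_space]) ?_
  rintro _ ⟨u, hu, rfl⟩ h
  have hu0 := hg.eq_zero_of_form_eq_zero hxy.symm (F.isotropic i u hu u hu)
    (h _ (Submodule.mem_map_of_mem hu))
  rw [hu0, map_zero]

theorem injective_map (hg : IsTransverseFamily g) (hr : 1 ≤ r) :
    Function.Injective fun x => F.map (idSum (g x)) (form_idSum (g x)) := by
  intro x y h
  by_contra hxy
  have hF : F.space ⟨0, hr⟩ ≠ ⊥ := Submodule.one_le_finrank_iff.1 (F.finrank_space ⟨0, hr⟩).ge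
  obtain ⟨u, hu, hu0⟩ := (Submodule.ne_bot_iff _).1 hF
  have hxu : idSum (g x) u ∈ (F.map (idSum (g y)) (form_idSum (g y))).space ⟨0, hr⟩ := by
    rw [← show F.map (idSum (g x)) _ = F.map (idSum (g y)) _ from h]
    exact Submodule.mem_map_of_mem hu
  exact hu0 (hg.eq_zero_of_form_eq_zero hxy (F.isotropic _ u hu u hu)
    (IsoFlag.isotropic _ _ _ hxu _ (Submodule.mem_map_of_mem hu)))

theorem continuous_map (hg : IsTransverseFamily g) :
    Continuous fun x => F.map (idSum (g x)) (form_idSum (g x)) := by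
  have hβ : Continuous fun x => ((idSumIsometry (g x) : Pseudo E S ≃ₗᵢ[ℝ] Pseudo E S) :
      Pseudo E S →L[ℝ] Pseudo E S) :=
    continuous_of_norm_sub_le (X := Pseudo E S →L[ℝ] Pseudo E S) hg.continuous
      fun x y => norm_idSumIsometry_sub_le (g x) (g y)
  refine continuous_induced_rng.2 (continuous_pi fun i => ?_)
  refine (hβ.clm_comp ((continuous_const (y := (F.space i).starProjection)).clm_comp
    (continuous_symm_of_continuous hβ))).congr fun x => ?_
  ext1 w
  exact (Submodule.starProjection_map_apply (idSumIsometry (g x)) (F.space i) w).symm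

theorem isEmbedding_map [CompactSpace P] (hg : IsTransverseFamily g) (hr : 1 ≤ r) :
    Topology.IsEmbedding fun x => F.map (idSum (g x)) (form_idSum (g x)) :=
  ((hg.continuous_map F).isClosedEmbedding (hg.injective_map F hr)).isEmbedding

theorem isTransverseSphere_range {m : ℕ} {g : Metric.sphere (0 : V (m + 1)) 1 → S ≃ₗᵢ[ℝ] S}
    (hg : IsTransverseFamily g) (hr : 1 ≤ r) :
    IsoFlag.IsTransverseSphere m
      (Set.range fun x => F.map (idSum (g x)) (form_idSum (g x))) := by
  refine ⟨⟨(hg.isEmbedding_map F hr).toHomeomorph.symm⟩, ?_⟩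
  rintro _ ⟨x, rfl⟩ _ ⟨y, rfl⟩ hne
  exact hg.transverse_map F fun h => hne (by rw [h])

end IsTransverseFamily

end TransverseFamily

/-! ### The spinor family -/

section SpinorFamily

variable {n : ℕ}

theorem isOrtho_negSq_of_inner_eq_zero {x y : V n} (h : inner ℝ x y = 0) :
    (negSq n).IsOrtho x y := by
  rw [QuadraticMap.isOrtho_def, negSq_apply, negSq_apply, negSq_apply, norm_add_sq_real, h]
  ring

variable {S : Type*} [NormedAddCommGroup S] [InnerProductSpace ℝ S] {η : Cl n →ₐ[ℝ] End ℝ S}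

theorem apply_ι_apply_ι (η : Cl n →ₐ[ℝ] End ℝ S) (x : V n) (s : S) :
    η (ι (negSq n) x) (η (ι (negSq n) x) s) = -(‖x‖ ^ 2 • s) := by
  rw [← End.mul_apply, ← map_mul, ι_sq_scalar, AlgHom.commutes, Module.algebraMap_end_apply,
    negSq_apply, neg_smul]

theorem IsSpinMetric.of_skew (h : ∀ (x : V n) (u v : S),
    inner ℝ (η (ι (negSq n) x) u) v = -inner ℝ u (η (ι (negSq n) x) v)) : IsSpinMetric η where
  orthogonal x hx u v := by
    rw [h, apply_ι_apply_ι, hx, one_pow, one_smul, inner_neg_right, neg_neg]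
  skew := h

theorem IsSpinMetric.norm_ι_apply (hη : IsSpinMetric η) (x : V n) (s : S) :
    ‖η (ι (negSq n) x) s‖ = ‖x‖ * ‖s‖ := by
  rw [← sq_eq_sq₀ (norm_nonneg _) (by positivity), ← real_inner_self_eq_norm_sq, hη.skew,
    apply_ι_apply_ι, inner_neg_right, neg_neg, real_inner_smul_right, real_inner_self_eq_norm_sq,
    mul_pow]

theorem norm_spinIsometry_sphereToSpin_sub (hη : IsSpinMetric η)
    (Sp : Subrepresentation (spinRep η)) (x₀ x y : Metric.sphere (0 : V n) 1)
    (s : Sp.toSubmodule) :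
    ‖spinIsometry hη Sp (sphereToSpin x₀ x) s - spinIsometry hη Sp (sphereToSpin x₀ y) s‖ =
      ‖(x : V n) - y‖ * ‖s‖ := by
  have hx₀ : ‖(x₀ : V n)‖ = 1 := by simp
  change ‖η (ι (negSq n) x₀ * ι (negSq n) x) s - η (ι (negSq n) x₀ * ι (negSq n) y) s‖ =
    _ * ‖(s : S)‖
  rw [← LinearMap.sub_apply, ← map_sub, ← mul_sub, ← map_sub, map_mul, End.mul_apply,
    hη.norm_ι_apply, hη.norm_ι_apply, hx₀, one_mul]

theorem isTransverseFamily_spinIsometry (hη : IsSpinMetric η) (Sp : Subrepresentation (spinRep η))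
    (x₀ : Metric.sphere (0 : V n) 1) :
    IsTransverseFamily fun x => spinIsometry hη Sp (sphereToSpin x₀ x) where
  continuous := continuous_of_norm_sub_le continuous_subtype_val fun x y =>
    ContinuousLinearMap.opNorm_le_bound _ (norm_nonneg _) fun s =>
      (norm_spinIsometry_sphereToSpin_sub hη Sp x₀ x y s).le
  eq_zero_of_apply_eq x y hxy s h := by
    have hs := norm_spinIsometry_sphereToSpin_sub hη Sp x₀ x y s
    rw [h, sub_self, norm_zero, eq_comm, mul_eq_zero] at hs
    exact norm_eq_zero.1 (hs.resolve_left
      (norm_ne_zero_iff.2 (sub_ne_zero.2 (Subtype.coe_injective.ne hxy))))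

end SpinorFamily

/-! ### The dimension of an irreducible spinor module -/

section EvenSubalgebra

variable {R M : Type*} [CommRing R] [AddCommGroup M] [Module R M] {Q : QuadraticForm R M}

theorem ι_mul_ι_mem_of_isUnit {C : Subalgebra R (CliffordAlgebra Q)} {v : M} (hv : IsUnit (Q v))
    (h : ∀ x, ι Q v * ι Q x ∈ C) (x y : M) : ι Q x * ι Q y ∈ C := by
  obtain ⟨a, ha⟩ := hv
  have hxv : ι Q x * ι Q v ∈ C := by
    rw [ι_mul_ι_comm]
    exact sub_mem (C.algebraMap_mem _) (h x)
  have hxy : ι Q x * ι Q y = (a⁻¹ : Rˣ) • (ι Q x * ι Q v * (ι Q v * ι Q y)) := by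
    rw [mul_assoc, ← mul_assoc (ι Q v), ι_sq_scalar, ← Algebra.smul_def, mul_smul_comm, ← ha,
      ← Units.smul_def, inv_smul_smul]
  exact hxy ▸ C.smul_mem (mul_mem hxv (h y)) _

theorem even_le_of_ι_mul_ι_mem {C : Subalgebra R (CliffordAlgebra Q)}
    (h : ∀ x y, ι Q x * ι Q y ∈ C) : even Q ≤ C := fun a ha => by
  induction a, ha using even_induction with
  | algebraMap r => exact C.algebraMap_mem r
  | add x y _ _ hx hy => exact add_mem hx hy
  | ι_mul_ι_mul x y a _ ih => exact mul_mem (h x y) ih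

theorem even_le_adjoin_ι_mul_ι {m : ℕ} (b : Basis (Fin (m + 1)) R M) (hb : IsUnit (Q (b 0))) :
    even Q ≤ Algebra.adjoin R (Set.range fun i : Fin m => ι Q (b 0) * ι Q (b i.succ)) := by
  refine even_le_of_ι_mul_ι_mem (ι_mul_ι_mem_of_isUnit hb fun x => ?_)
  rw [← b.sum_repr x, map_sum, Finset.mul_sum]
  refine sum_mem fun i _ => ?_
  rw [map_smul, mul_smul_comm]
  refine Subalgebra.smul_mem _ ?_ _
  cases i using Fin.cases with
  | zero => exact ι_sq_scalar Q (b 0) ▸ Subalgebra.algebraMap_mem _ _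
  | succ i => exact Algebra.subset_adjoin ⟨i, rfl⟩

end EvenSubalgebra

theorem CliffordSystem.map {A B : Type*} [Ring A] [Ring B] {es fs : List A}
    (h : CliffordSystem es fs) (φ : A →+* B) : CliffordSystem (es.map φ) (fs.map φ) where
  sq_eq_neg_one := by
    simp only [List.forall_mem_map]
    exact fun e he => by rw [← map_mul, h.sq_eq_neg_one e he, map_neg, map_one]
  sq_eq_one := by
    simp only [List.forall_mem_map]
    exact fun f hf => by rw [← map_mul, h.sq_eq_one f hf, map_one]
  pairwise := by
    rw [← List.map_append, List.pairwise_map]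
    exact h.pairwise.imp fun {a b} hab => by
      rw [Anticommute, ← map_mul, show a * b = -(b * a) from hab, map_neg, map_mul]

/-- The standard orthonormal basis of `ℝⁿ`, as unit vectors. -/
noncomputable def stdVector {n : ℕ} (i : Fin n) : Metric.sphere (0 : V n) 1 :=
  ⟨EuclideanSpace.basisFun (Fin n) ℝ i, by simp⟩

/-- The products `e₀ eᵢ` of standard basis vectors with `i ≠ 0`; they generate the even part of
`Cl(m + 1)`. -/
noncomputable def evenGenerators (m : ℕ) : List (Cl (m + 1)) :=
  List.ofFn fun i : Fin m => (sphereToSpin (stdVector 0) (stdVector i.succ) : Cl (m + 1))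

section EvenGenerators

variable {m : ℕ}

theorem cliffordSystem_evenGenerators : CliffordSystem (evenGenerators m) [] := by
  have hanti : ∀ i j : Fin (m + 1), i ≠ j →
      Anticommute (ι (negSq (m + 1)) (stdVector i)) (ι (negSq (m + 1)) (stdVector j)) :=
    fun i j hij => ι_mul_ι_comm_of_isOrtho (isOrtho_negSq_of_inner_eq_zero
      ((EuclideanSpace.basisFun _ ℝ).orthonormal.2 hij))
  refine ⟨List.forall_mem_ofFn_iff.2 fun i => ?_, by simp, ?_⟩
  · exact (hanti 0 i.succ (Fin.succ_ne_zero i).symm).mul_mul_self_of_sq_eq_neg_one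
      (unit_sq _) (unit_sq _)
  · rw [List.append_nil, evenGenerators, List.pairwise_ofFn]
    exact fun i j hij => (hanti _ 0 (Fin.succ_ne_zero i)).mul_mul_of_anticommute
      (hanti _ 0 (Fin.succ_ne_zero j)) (hanti _ _ (by simpa using hij.ne))

theorem even_le_adjoin_evenGenerators :
    even (negSq (m + 1)) ≤ Algebra.adjoin ℝ {g | g ∈ evenGenerators m} := by
  have hset : {g | g ∈ evenGenerators m} = Set.range fun i : Fin m =>
      (sphereToSpin (stdVector 0) (stdVector i.succ) : Cl (m + 1)) :=
    Set.ext fun g => List.mem_ofFn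
  have h0 : IsUnit (negSq (m + 1) ((EuclideanSpace.basisFun _ ℝ).toBasis 0)) := by
    simp [negSq_apply]
  have hgen := even_le_adjoin_ι_mul_ι _ h0
  rw [OrthonormalBasis.coe_toBasis] at hgen
  exact hset ▸ hgen

variable {S : Type*} [NormedAddCommGroup S] [InnerProductSpace ℝ S]

theorem isInvariantUnder_map_evenGenerators_iff (η : Cl (m + 1) →ₐ[ℝ] End ℝ S)
    {U : Submodule ℝ S} : IsInvariantUnder {g | g ∈ (evenGenerators m).map η ++ []} U ↔
      ∀ g : Spin (m + 1), U ∈ End.invtSubmodule (spinRep η g) := by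
  have hset : {g | g ∈ (evenGenerators m).map η ++ []} = η '' {g | g ∈ evenGenerators m} := by
    ext; simp
  rw [hset]
  refine ⟨fun h g => h.mem_of_mem_adjoin ?_, fun h => ?_⟩
  · rw [← AlgHom.map_adjoin]
    exact ⟨g, even_le_adjoin_evenGenerators (spinGroup.mem_even g.2), rfl⟩
  · rintro _ ⟨g, hg, rfl⟩
    obtain ⟨i, rfl⟩ := List.mem_ofFn.1 hg
    exact h (sphereToSpin (stdVector 0) (stdVector i.succ))

theorem exists_subrepresentation_le_finrank_eq_d (η : Cl (m + 1) →ₐ[ℝ] End ℝ S)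
    {N : Subrepresentation (spinRep η)} (hN : N ≠ ⊥) : ∃ U ≤ N,
      FiniteDimensional ℝ U.toSubmodule ∧ finrank ℝ U.toSubmodule = d (m + 1) := by
  have hsys := cliffordSystem_evenGenerators.map (η : Cl (m + 1) →+* End ℝ S)
  obtain ⟨U, hUN, hU, hUd⟩ := signatureHasInvariantSubspaces_d m S
    ((evenGenerators m).map η) [] (by simp [evenGenerators]) rfl hsys N.toSubmodule
    (fun h => hN (Subrepresentation.toSubmodule_injective h))
    ((isInvariantUnder_map_evenGenerators_iff η).2 fun g _ hs => N.apply_mem_toSubmodule g hs)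
  exact ⟨⟨U, (isInvariantUnder_map_evenGenerators_iff η).1 hU⟩, hUN, hUd⟩

end EvenGenerators

theorem d_pos (n : ℕ) : 0 < d n := by
  unfold d
  split <;> positivity

theorem two_le_d {n : ℕ} (hn : 2 ≤ n) : 2 ≤ d n := by
  by_cases h : (n - 1) / 8 = 0
  · have : n ≤ 8 := by omega
    interval_cases n <;> decide
  · have h1 : 16 ≤ 16 ^ ((n - 1) / 8) := Nat.le_self_pow h 16
    have h2 : ∀ c, 1 ≤ c → 2 ≤ c * 16 ^ ((n - 1) / 8) := fun c hc => by nlinarith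
    unfold d
    split <;> exact h2 _ (by norm_num)

theorem finrank_eq_d_of_isIrreducible {m : ℕ} {S : Type*} [NormedAddCommGroup S]
    [InnerProductSpace ℝ S] {η : Cl (m + 1) →ₐ[ℝ] End ℝ S} {Sp : Subrepresentation (spinRep η)}
    (hSp : Sp.toRepresentation.IsIrreducible) : finrank ℝ Sp.toSubmodule = d (m + 1) := by
  have hne : Sp ≠ ⊥ := by
    rintro rfl
    refine bot_ne_top (α := Subrepresentation (⊥ : Subrepresentation (spinRep η)).toRepresentation)
      (Subrepresentation.toSubmodule_injective ?_)
    exact Subsingleton.elim (α := Submodule ℝ (⊥ : Submodule ℝ S)) _ _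
  obtain ⟨U, hUN, -, hUd⟩ := exists_subrepresentation_le_finrank_eq_d η hne
  let U' : Subrepresentation Sp.toRepresentation :=
    ⟨U.toSubmodule.comap Sp.toSubmodule.subtype, fun g s hs => U.apply_mem_toSubmodule g hs⟩
  have hU' : U'.toSubmodule.map Sp.toSubmodule.subtype = U.toSubmodule := by
    rw [Submodule.map_comap_subtype, inf_eq_right.2 (show U.toSubmodule ≤ Sp.toSubmodule from hUN)]
  rcases hSp.eq_bot_or_eq_top U' with h | h
  · have hbot : U.toSubmodule = ⊥ := by
      rw [← hU', congrArg Subrepresentation.toSubmodule h]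
      exact Submodule.map_bot _
    rw [hbot, finrank_bot] at hUd
    exact absurd hUd (d_pos _).ne
  · have htop : U.toSubmodule = Sp.toSubmodule := by
      rw [← hU', congrArg Subrepresentation.toSubmodule h]
      exact Submodule.map_subtype_top _
    rw [← htop, hUd]

/-! ### Existence of spin metrics and of isotropic flags -/

theorem exists_linearMap_skew_matrix (n : ℕ) :
    ∃ (κ : Type) (_ : Fintype κ) (_ : DecidableEq κ) (_ : Nonempty κ)
      (f : (Fin n → ℝ) →ₗ[ℝ] Matrix κ κ ℝ),
      ∀ x, (f x).transpose = -f x ∧ f x * f x = -(∑ i, x i ^ 2) • 1 := by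
  induction n with
  | zero => exact ⟨Unit, inferInstance, inferInstance, inferInstance, 0, by simp⟩
  | succ n ih =>
    obtain ⟨κ, _, _, _, f, hf⟩ := ih
    refine ⟨κ ⊕ κ, inferInstance, inferInstance, inferInstance,
      { toFun := fun x => .fromBlocks (f (Fin.tail x)) (-(x 0 • 1)) (x 0 • 1) (-f (Fin.tail x))
        map_add' := fun x y => ?_
        map_smul' := fun c x => ?_ }, fun x => ⟨?_, ?_⟩⟩
    · rw [Matrix.fromBlocks_add, show Fin.tail (x + y) = Fin.tail x + Fin.tail y from rfl, map_add,
        Pi.add_apply, add_smul, neg_add, neg_add]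
    · rw [RingHom.id_apply, Matrix.fromBlocks_smul, show Fin.tail (c • x) = c • Fin.tail x from rfl,
        map_smul, Pi.smul_apply, smul_assoc, smul_neg, smul_neg]
    · simp [Matrix.fromBlocks_transpose, Matrix.fromBlocks_neg, (hf _).1]
    · have hsq : -(∑ i, x i ^ 2) • (1 : Matrix κ κ ℝ) =
          f (Fin.tail x) * f (Fin.tail x) - (x 0 * x 0) • 1 := by
        rw [(hf _).2, Fin.sum_univ_succ, neg_add, add_smul, ← sq, neg_smul (x 0 ^ 2)]
        exact neg_add_eq_sub (x 0 ^ 2 • (1 : Matrix κ κ ℝ)) _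
      rw [← Matrix.fromBlocks_one, Matrix.fromBlocks_smul, hsq]
      simp [Matrix.fromBlocks_multiply, smul_smul, sub_eq_add_neg, add_comm]

theorem exists_isSpinMetric (n : ℕ) :
    ∃ (κ : Type) (_ : Fintype κ) (_ : Nonempty κ) (η : Cl n →ₐ[ℝ] End ℝ (EuclideanSpace ℝ κ)),
      IsSpinMetric η := by
  obtain ⟨κ, _, _, _, f, hf⟩ := exists_linearMap_skew_matrix n
  let A : V n →ₗ[ℝ] Matrix κ κ ℝ := f ∘ₗ (WithLp.linearEquiv 2 ℝ (Fin n → ℝ)).toLinearMap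
  have hA : ∀ x, A x * A x = algebraMap ℝ (Matrix κ κ ℝ) (negSq n x) := fun x => by
    rw [Algebra.algebraMap_eq_smul_one, negSq_apply, EuclideanSpace.real_norm_sq_eq]
    exact (hf _).2
  have hA_transpose : ∀ x, (A x).transpose = -A x := fun x => (hf _).1
  refine ⟨κ, inferInstance, inferInstance,
    (Matrix.toLpLinAlgEquiv 2).toAlgHom.comp (CliffordAlgebra.lift (negSq n) ⟨A, hA⟩),
    .of_skew fun x u v => ?_⟩
  have hη : (Matrix.toLpLinAlgEquiv 2).toAlgHom.comp (CliffordAlgebra.lift (negSq n) ⟨A, hA⟩)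
      (ι (negSq n) x) = Matrix.toEuclideanLin (A x) := by
    rw [AlgHom.comp_apply, CliffordAlgebra.lift_ι_apply]
    rfl
  rw [hη, ← LinearMap.adjoint_inner_right, ← Matrix.toEuclideanLin_conjTranspose_eq_adjoint,
    Matrix.conjTranspose_eq_transpose_of_trivial, hA_transpose, map_neg, LinearMap.neg_apply,
    inner_neg_right]

section IsotropicFlags

variable {E S : Type*} [NormedAddCommGroup E] [InnerProductSpace ℝ E]
  [NormedAddCommGroup S] [InnerProductSpace ℝ S] {r : ℕ}

theorem nonempty_isoFlag_of_isotropic {w : Fin r → Pseudo E S} (hw : LinearIndependent ℝ w)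
    (hiso : ∀ i j, form E S (w i) (w j) = 0) : Nonempty (IsoFlag E S r) := by
  have hspan : ∀ u ∈ Submodule.span ℝ (Set.range w), ∀ v ∈ Submodule.span ℝ (Set.range w),
      form E S u v = 0 := fun u hu v hv => by
    induction hu, hv using Submodule.span_induction₂ with
    | mem_mem u v hu hv =>
      obtain ⟨i, rfl⟩ := hu
      obtain ⟨j, rfl⟩ := hv
      exact hiso i j
    | zero_left => simp
    | zero_right => simp
    | add_left x y z _ _ _ hx hy => simp [hx, hy]
    | add_right x y z _ _ _ hx hy => simp [hx, hy]
    | smul_left c x y _ _ h => simp [h]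
    | smul_right c x y _ _ h => simp [h]
  refine ⟨fun i => Submodule.span ℝ (Set.range (w ∘ Fin.castLE (Nat.succ_le_of_lt i.2))),
    fun i => ?_, fun i j hij => Submodule.span_mono ?_, fun i u hu v hv => ?_⟩
  · rw [finrank_span_eq_card (hw.comp _ (Fin.castLE_injective _)), Fintype.card_fin]
  · rintro _ ⟨k, rfl⟩
    exact ⟨Fin.castLE (Nat.succ_le_succ hij) k, rfl⟩
  · exact hspan u (Submodule.span_mono (Set.range_comp_subset_range _ _) hu)
      v (Submodule.span_mono (Set.range_comp_subset_range _ _) hv)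

theorem nonempty_isoFlag [FiniteDimensional ℝ E] [FiniteDimensional ℝ S]
    (hE : r ≤ finrank ℝ E) (hS : r ≤ finrank ℝ S) : Nonempty (IsoFlag E S r) := by
  have he := (stdOrthonormalBasis ℝ E).orthonormal.comp _ (Fin.castLE_injective hE)
  have hf := (stdOrthonormalBasis ℝ S).orthonormal.comp _ (Fin.castLE_injective hS)
  refine nonempty_isoFlag_of_isotropic (w := fun i => WithLp.toLp 2
    (stdOrthonormalBasis ℝ E (Fin.castLE hE i), stdOrthonormalBasis ℝ S (Fin.castLE hS i)))
    (.of_comp (WithLp.fstₗ 2 ℝ E S) he.linearIndependent) fun i j => ?_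
  exact sub_eq_zero.2 ((orthonormal_iff_ite.1 he i j).trans (orthonormal_iff_ite.1 hf i j).symm)

end IsotropicFlags

theorem exists_isTransverseSphere {m p r : ℕ} (hr : 1 ≤ r) (hp : r ≤ p) (hd : r ≤ d (m + 1)) :
    ∃ Λ : Set (Iso p (d (m + 1)) r), IsoFlag.IsTransverseSphere m Λ := by
  obtain ⟨κ, _, _, η, hη⟩ := exists_isSpinMetric (m + 1)
  have htop : (⊤ : Subrepresentation (spinRep η)) ≠ ⊥ := fun h =>
    top_ne_bot (congrArg Subrepresentation.toSubmodule h)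
  obtain ⟨U, -, _, hU⟩ := exists_subrepresentation_le_finrank_eq_d η htop
  obtain ⟨F⟩ : Nonempty (Iso p (d (m + 1)) r) := nonempty_isoFlag (by simpa) (by simpa)
  have hg := (isTransverseFamily_spinIsometry hη U (stdVector 0)).conj
    ((stdOrthonormalBasis ℝ U.toSubmodule).reindex (finCongr hU)).repr
  exact ⟨_, hg.isTransverseSphere_range F hr⟩

end TransverseSpinor

theorem mainTheorem7_general (n : ℕ) (hn : 1 ≤ n) :
    (∀ (S : Type*) [NormedAddCommGroup S] [InnerProductSpace ℝ S]
      (η : TransverseSpinor.Cl n →ₐ[ℝ] Module.End ℝ S)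
      (Sp : Subrepresentation (TransverseSpinor.spinRep η)),
      Sp.toRepresentation.IsIrreducible →
        Module.finrank ℝ Sp.toSubmodule = TransverseSpinor.d n) ∧
    (∀ (E S : Type*) [NormedAddCommGroup E] [InnerProductSpace ℝ E]
      [NormedAddCommGroup S] [InnerProductSpace ℝ S]
      (η : TransverseSpinor.Cl n →ₐ[ℝ] Module.End ℝ S)
      (hη : TransverseSpinor.IsSpinMetric η)
      (Sp : Subrepresentation (TransverseSpinor.spinRep η))
      (x₀ : Metric.sphere (0 : TransverseSpinor.V n) 1) (r : ℕ), 1 ≤ r →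
      ∀ F : TransverseSpinor.IsoFlag E Sp.toSubmodule r,
        let β := fun x => TransverseSpinor.spinIsometry hη Sp (TransverseSpinor.sphereToSpin x₀ x)
        Topology.IsEmbedding
            (fun x => F.map (TransverseSpinor.idSum (β x)) (TransverseSpinor.form_idSum (β x))) ∧
          TransverseSpinor.IsoFlag.IsTransverseSphere (n - 1) (Set.range fun x =>
            F.map (TransverseSpinor.idSum (β x)) (TransverseSpinor.form_idSum (β x)))) ∧
    ∀ p r : ℕ, 1 ≤ r → r ≤ p → r ≤ TransverseSpinor.d n →
      ∃ Λ : Set (TransverseSpinor.Iso p (TransverseSpinor.d n) r),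
        TransverseSpinor.IsoFlag.IsTransverseSphere (n - 1) Λ := by
  obtain ⟨m, rfl⟩ : ∃ m, n = m + 1 := ⟨n - 1, (Nat.sub_add_cancel hn).symm⟩
  refine ⟨fun S _ _ η Sp hSp => TransverseSpinor.finrank_eq_d_of_isIrreducible hSp,
    fun E S _ _ _ _ η hη Sp x₀ r hr F => ?_,
    fun p r hr hp hd => TransverseSpinor.exists_isTransverseSphere hr hp hd⟩
  have hβ := TransverseSpinor.isTransverseFamily_spinIsometry hη Sp x₀
  exact ⟨hβ.isEmbedding_map F hr, hβ.isTransverseSphere_range F hr⟩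

theorem mainTheorem7 (n : ℕ) (hn : 1 ≤ n) :
    (∀ (S : Type*) [NormedAddCommGroup S] [InnerProductSpace ℝ S]
      (η : TransverseSpinor.Cl n →ₐ[ℝ] Module.End ℝ S)
      (_ : (TransverseSpinor.clRep η).IsIrreducible)
      (hη : TransverseSpinor.IsSpinMetric η)
      (Sp : Subrepresentation (TransverseSpinor.spinRep η))
      (_ : Sp.toRepresentation.IsIrreducible),
      Module.finrank ℝ Sp.toSubmodule = TransverseSpinor.d n ∧
      ∀ (x₀ : Metric.sphere (0 : TransverseSpinor.V n) 1) (p r : ℕ), 1 ≤ p → 1 ≤ r →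
        r ≤ min p (TransverseSpinor.d n) →
        ∀ F : TransverseSpinor.IsoFlag (EuclideanSpace ℝ (Fin p)) Sp.toSubmodule r,
          Topology.IsEmbedding (TransverseSpinor.orbitMap hη Sp x₀ F) ∧
          TransverseSpinor.IsoFlag.IsTransverseSphere (n - 1)
            (Set.range (TransverseSpinor.orbitMap hη Sp x₀ F))) ∧
    (2 ≤ n →
      ∃ Λ : Set (TransverseSpinor.Iso (TransverseSpinor.d n - 1) (TransverseSpinor.d n)
          (TransverseSpinor.d n - 1)),
        TransverseSpinor.IsoFlag.IsTransverseSphere (n - 1) Λ) := by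
  obtain ⟨hdim, horbit, hex⟩ := mainTheorem7_general n hn
  exact ⟨fun S _ _ η _ hη Sp hSp =>
      ⟨hdim S η Sp hSp, fun x₀ p r _ hr _ => horbit _ S η hη Sp x₀ r hr⟩,
    fun h2 => hex _ _ (Nat.le_sub_of_add_le (TransverseSpinor.two_le_d h2)) le_rfl (Nat.sub_le _ _)⟩
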